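/- **Setting.** Let $C^\infty(S^1)$ be the space of smooth complex-valued functions on the circle $S^1=\mathbb R/2\pi\mathbb Z$ with coordinate $x$, and let $\mathrm{Vect}(S^1)$ be the Lie algebra of smooth real vector fields $f\partial$, $\partial=d/dx$, with $[f\partial,g\partial]=(fg'-f'g)\partial$. Let $\Psi\mathrm D(S^1)$ be the space of symbols $F=\sum_{k\in\mathbb Z}F_k(x)\xi^k$, $F_k\in C^\infty(S^1)$, $F_k=0$ for all large $k$, with the product $$F\circ G=\sum_{k\ge 0}\frac1{k!}:\!\partial_\xi^kF\;\partial_x^kG\!:\,,\qquad :\!u\xi^i\,v\xi^j\!:\;=uv\,\xi^{i+j},$$ and the Lie bracket $[F,G]=F\circ G-G\circ F$. For $h\in(0,1]$ let $\Phi_h(u\xi^k)=h^ku\xi^k$, and let $\Psi\mathrm D_h(S^1)$ be the same space with the product $F\circ_hG=\Phi_h^{-1}(\Phi_hF\circ\Phi_hG)$ and the Lie bracket $\frac1h(F\circ_hG-G\circ_hF)$. In all cases $\pi(f\partial)=f\xi$ is the standard embedding. A *polynomial deformation* of $\pi$ is a family of real-linear Lie algebra homomorphisms $\rho(t)=\sum_k\rho_k(t)\xi^k$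 from $\mathrm{Vect}(S^1)$ to $\Psi\mathrm D(S^1)$ (respectively $\Psi\mathrm D_h(S^1)$), defined for all $t\in\mathbb C^n$ for some $n\ge 0$, such that $\rho(0)=\pi$, such that each $\rho_k(t)$ is a polynomial in $t$ whose coefficients are linear maps $\mathrm{Vect}(S^1)\to C^\infty(S^1)$, and such that $\rho_k\equiv0$ for all sufficiently large $k$. Let $\theta_0(f\partial)=f$, $\theta_1(f\partial)=f'$, $$\theta_2(f\partial)=\sum_{n\ge2}(-1)^{n-1}\frac{2(n-3)}n f^{(n)}\xi^{1-n},\qquad \theta_3(f\partial)=\sum_{n\ge2}(-1)^n\frac{3(n-1)}{n+1}f^{(n+1)}\xi^{-n}.$$ For $c=(c_0,c_1,c_2,c_3)\in\mathbb C^4$ let $I_c(f\partial)=f\xi+\sum_{i=0}^3c_i\theta_i(f\partial)$; for $\Psi\mathrm D_h(S^1)$ replace $\theta_0,\theta_1,\theta_2,\theta_3$ in this formula by $\Phi_h^{-1}\theta_0,\ \Phi_h^{-1}\theta_1,\ h^{-1}\Phi_h^{-1}\theta_2,\ h^{-2}\Phi_h^{-1}\theta_3$. In both cases $I_c(f\partial)=f\xi+c_0f+c_1f'+c_2f''\xi^{-1}+c_3f'''\xi^{-2}+\cdots$,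 where the dots stand for terms in $\xi^{-3},\xi^{-4},\dots$. The infinitesimal deformation $I_c$ *extends to a polynomial deformation* if there are a polynomial deformation $\rho$, a parameter value $t$, and constants $a,b\in\mathbb C$ such that for all $f$ $$\rho(t)(f\partial)=I_c(f\partial)+c_0\,(a f'\xi^{-1}+b f''\xi^{-2})+(\text{terms in }\xi^{-3},\xi^{-4},\dots).$$ (For $c_0=0$ there is no correction term.) **Theorem.** (1) For every $c\in\mathbb C^4$, the infinitesimal deformation $I_c$ of the standard embedding $\mathrm{Vect}(S^1)\to\Psi\mathrm D(S^1)$ extends to a polynomial deformation if and only if $$6c_1^3c_3-3c_1^2c_2^2-18c_1c_2c_3+8c_2^3+9c_3^2+3c_1^3c_2-6c_1c_2^2-9c_1^2c_3+18c_2c_3+3c_1c_3-5c_1^2c_2+8c_2^2+2c_1c_2=0.$$ (2) For every $h\in(0,1]$ and every $c\in\mathbb C^4$, the infinitesimal deformation $I_c$ of the standard embedding $\mathrm{Vect}(S^1)\to\Psi\mathrm D_h(S^1)$ extends to a polynomial deformation if and only if $$\begin{aligned}&6c_1^3c_3-3c_1^2c_2^2-18c_1c_2c_3+8c_2^3+9c_3^2+h\,(3c_1^3c_2-6c_1c_2^2-9c_1^2c_3+18c_2c_3)\\&\qquad+h^2(3c_1c_3-5c_1^2c_2+8c_2^2)+h^3(2c_1c_2)=0.\end{aligned}$$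 -/

import Mathlib

open scoped ContDiff

noncomputable section

namespace PseudoDiff

/-! ## Smooth functions and vector fields on the circle `S¹ = ℝ / 2πℤ` -/

/-- Smooth `𝕜`-valued functions on the circle, as `2π`-periodic smooth functions of `x : ℝ`. -/
def CircleFun (𝕜 : Type) [RCLike 𝕜] : Subalgebra 𝕜 (ℝ → 𝕜) where
  carrier := {f | ContDiff ℝ ∞ f ∧ Function.Periodic f (2 * Real.pi)}
  mul_mem' hf hg := ⟨hf.1.mul hg.1, hf.2.mul hg.2⟩
  add_mem' hf hg := ⟨hf.1.add hg.1, hf.2.add hg.2⟩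
  algebraMap_mem' _ := ⟨contDiff_const, fun _ => rfl⟩

/-- The derivative `f ↦ f' = df/dx`. -/
def D {𝕜 : Type} [RCLike 𝕜] : CircleFun 𝕜 →ₗ[𝕜] CircleFun 𝕜 where
  toFun f := ⟨deriv (f : ℝ → 𝕜), (contDiff_infty_iff_deriv.1 f.2.1).2, fun x => by
    rw [← deriv_comp_add_const]
    exact congrArg (fun g => deriv g x) (funext f.2.2)⟩
  map_add' f g := Subtype.ext <| funext fun _ =>
    deriv_add ((contDiff_infty_iff_deriv.1 f.2.1).1 _) ((contDiff_infty_iff_deriv.1 g.2.1).1 _)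
  map_smul' a f := Subtype.ext <| funext fun _ =>
    deriv_const_smul a ((contDiff_infty_iff_deriv.1 f.2.1).1 _)

/-- A real function on the circle, regarded as a complex one. -/
def toComplex : CircleFun ℝ →ₗ[ℝ] CircleFun ℂ where
  toFun f := ⟨fun x => ((f : ℝ → ℝ) x : ℂ), Complex.ofRealCLM.contDiff.comp f.2.1,
    fun x => congrArg Complex.ofReal (f.2.2 x)⟩
  map_add' _ _ := Subtype.ext <| funext fun _ => Complex.ofReal_add _ _
  map_smul' a f := Subtype.ext <| funext fun x => by
    change ((a * (f : ℝ → ℝ) x : ℝ) : ℂ) = a • (((f : ℝ → ℝ) x : ℝ) : ℂ)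
    simp

/-- `Vect(S¹)`: the function `f` stands for the smooth real vector field `f ∂`, `∂ = d/dx`. -/
abbrev Vect : Type := CircleFun ℝ

/-- The bracket of vector fields, `[f∂, g∂] = (f g' - f' g) ∂`. -/
def vectBracket (f g : Vect) : Vect := f * D g - D f * g

/-- The (complex-valued) `n`-th derivative `f⁽ⁿ⁾` of the coefficient of the field `f ∂`. -/
def der (n : ℕ) (f : Vect) : CircleFun ℂ := D^[n] (toComplex f)

/-! ## Pseudodifferential symbols -/

/-- The space of symbols `F = ∑ₖ Fₖ(x) ξᵏ`, `k ∈ ℤ`, with `Fₖ = 0` for all large `k`. -/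
def PsiD : Submodule ℂ (ℤ → CircleFun ℂ) where
  carrier := {F | ∃ N : ℤ, ∀ k, N < k → F k = 0}
  add_mem' := by
    rintro F G ⟨N, hN⟩ ⟨M, hM⟩
    refine ⟨max N M, fun k hk => ?_⟩
    rw [Pi.add_apply, hN k (lt_of_le_of_lt (le_max_left _ _) hk),
      hM k (lt_of_le_of_lt (le_max_right _ _) hk), add_zero]
  zero_mem' := ⟨0, fun _ _ => rfl⟩
  smul_mem' := by
    rintro a F ⟨N, hN⟩
    exact ⟨N, fun k hk => by rw [Pi.smul_apply, hN k hk, smul_zero]⟩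

/-- The coefficient `Fₖ` of `ξᵏ`. -/
def coef (F : PsiD) (k : ℤ) : CircleFun ℂ := (F : ℤ → CircleFun ℂ) k

/-- `F` has order at most `m`. -/
def OrderLE (F : PsiD) (m : ℤ) : Prop := ∀ k, m < k → coef F k = 0

/-- The symbol `u(x) ξᵏ`. -/
def mono (k : ℤ) (u : CircleFun ℂ) : PsiD :=
  ⟨Pi.single k u, k, fun j hj => by rw [Pi.single_eq_of_ne (ne_of_gt hj)]⟩

/-- The contribution to the coefficient of `ξᵐ` in `F ∘ G = ∑ₖ (1/k!) :∂_ξᵏ F ∂ₓᵏ G:` of the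
term `Fᵢ ξⁱ` of `F` and of the index `k`: since `(1/k!) ∂_ξᵏ ξⁱ = (i choose k) ξ^(i-k)`, it is
`(i choose k) Fᵢ ∂ₓᵏ Gⱼ` with `i - k + j = m`. -/
def compTerm (F G : PsiD) (m : ℤ) (p : ℤ × ℕ) : CircleFun ℂ :=
  Ring.choose p.1 p.2 • (coef F p.1 * D^[p.2] (coef G (m + p.2 - p.1)))

theorem iterate_D_zero (k : ℕ) : D^[k] (0 : CircleFun ℂ) = 0 := by
  induction k with
  | zero => rfl
  | succ k ih => rw [Function.iterate_succ_apply, map_zero, ih]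

theorem compTerm_eq_zero {F G : PsiD} {N M : ℤ} (hF : OrderLE F N) (hG : OrderLE G M)
    {m : ℤ} {p : ℤ × ℕ} (h : N < p.1 ∨ M < m + p.2 - p.1) : compTerm F G m p = 0 := by
  unfold compTerm
  rcases h with h | h
  · rw [hF _ h, zero_mul, smul_zero]
  · rw [hG _ h, iterate_D_zero, mul_zero, smul_zero]

/-- Each coefficient of a product is a finite sum. -/
theorem compTerm_support_finite (F G : PsiD) (m : ℤ) :
    (Function.support (compTerm F G m)).Finite := by
  obtain ⟨N, hN⟩ := F.2
  obtain ⟨M, hM⟩ := G.2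
  refine ((Set.finite_Icc (m - M) N).prod (Set.finite_Iic (N + M - m).toNat)).subset ?_
  intro p hp
  by_contra hc
  refine hp (compTerm_eq_zero (N := N) (M := M) hN hM ?_)
  simp only [Set.mem_prod, Set.mem_Icc, Set.mem_Iic] at hc
  omega

/-- The product `F ∘ G` of symbols. -/
def comp (F G : PsiD) : PsiD :=
  ⟨fun m => ∑ᶠ p : ℤ × ℕ, compTerm F G m p, by
    obtain ⟨N, hN⟩ := F.2
    obtain ⟨M, hM⟩ := G.2
    refine ⟨N + M, fun m hm => finsum_eq_zero_of_forall_eq_zero fun p => ?_⟩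
    refine compTerm_eq_zero (N := N) (M := M) hN hM ?_
    omega⟩

/-- The commutator `[F, G] = F ∘ G - G ∘ F`: the Lie bracket of `ΨD(S¹)`. -/
def bracket (F G : PsiD) : PsiD := comp F G - comp G F

/-- The linear map `Φ_h`, `u ξᵏ ↦ hᵏ u ξᵏ`. -/
def Phi (h : ℝ) : PsiD →ₗ[ℂ] PsiD where
  toFun F := ⟨fun k => ((h : ℂ) ^ k) • coef F k, by
    obtain ⟨N, hN⟩ := F.2
    exact ⟨N, fun k hk => by
      change ((h : ℂ) ^ k) • (F : ℤ → CircleFun ℂ) k = 0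
      rw [hN k hk, smul_zero]⟩⟩
  map_add' F G := Subtype.ext <| funext fun _ => smul_add _ _ _
  map_smul' a F := Subtype.ext <| funext fun k => smul_comm ((h : ℂ) ^ k) a (coef F k)

/-- For `h ≠ 0` the inverse of `Φ_h` is `Φ_{1/h}`. -/
theorem Phi_inv_Phi {h : ℝ} (hh : h ≠ 0) (F : PsiD) : Phi h⁻¹ (Phi h F) = F := by
  refine Subtype.ext <| funext fun k => ?_
  have h0 : (h : ℂ) ≠ 0 := by exact_mod_cast hh
  have key : (((h⁻¹ : ℝ) : ℂ) ^ k) • (((h : ℂ) ^ k) • coef F k) = coef F k := by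
    rw [smul_smul, ← mul_zpow, Complex.ofReal_inv, inv_mul_cancel₀ h0, one_zpow, one_smul]
  exact key

/-- The product `F ∘_h G = Φ_h⁻¹(Φ_h F ∘ Φ_h G)` of `ΨD_h(S¹)`. -/
def compH (h : ℝ) (F G : PsiD) : PsiD := Phi h⁻¹ (comp (Phi h F) (Phi h G))

/-- The Lie bracket `(1/h) (F ∘_h G - G ∘_h F)` of `ΨD_h(S¹)`. With the factor `1/h` it tends
to the Poisson bracket as `h → 0`, and `f ∂ ↦ f ξ` is a homomorphism for every `h`. -/
def bracketH (h : ℝ) (F G : PsiD) : PsiD := ((h : ℂ)⁻¹) • (compH h F G - compH h G F)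

/-! ## Polynomial deformations of the standard embedding -/

/-- The standard embedding `f ∂ ↦ f ξ`. -/
def stdEmbedding (f : Vect) : PsiD := mono 1 (der 0 f)

/-- `c ↦ T c` is polynomial in `c ∈ ℂⁿ`: `T c = ∑_α c^α A_α`, a finite sum over multi-indices,
with linear maps `A_α : Vect(S¹) → C^∞(S¹)`. -/
def IsPolynomialFamily {n : ℕ} (T : (Fin n → ℂ) → Vect → CircleFun ℂ) : Prop :=
  ∃ (S : Finset (Fin n → ℕ)) (A : (Fin n → ℕ) → Vect →ₗ[ℝ] CircleFun ℂ),
    ∀ c f, T c f = ∑ α ∈ S, (∏ i, c i ^ α i) • A α f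

/-- A polynomial deformation of the standard embedding, with values in the space of symbols with
the Lie bracket `B`: a family `ρ c = ∑ₖ ρₖ(c) ξᵏ` of homomorphisms, `c ∈ ℂⁿ`, that is the
standard embedding at `c = 0`, whose coefficients are polynomial in `c`, and vanish for all
large `k`. -/
structure IsPolynomialDeformation (B : PsiD → PsiD → PsiD) {n : ℕ}
    (ρ : (Fin n → ℂ) → Vect →ₗ[ℝ] PsiD) : Prop where
  hom : ∀ c f g, ρ c (vectBracket f g) = B (ρ c f) (ρ c g)
  at_zero : ∀ f, ρ 0 f = stdEmbedding f
  polynomial : ∀ k : ℤ, IsPolynomialFamily fun c f => coef (ρ c f) k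
  bounded : ∃ N : ℤ, ∀ c f, OrderLE (ρ c f) N

/-! ## The infinitesimal deformations -/

/-- `θ₀(f∂) = f`. -/
def theta0 (f : Vect) : PsiD := mono 0 (der 0 f)

/-- `θ₁(f∂) = f'`. -/
def theta1 (f : Vect) : PsiD := mono 0 (der 1 f)

/-- `θ₂(f∂) = ∑_{n ≥ 2} (-1)^(n-1) (2(n-3)/n) f⁽ⁿ⁾ ξ^(1-n)`. -/
def theta2 (f : Vect) : PsiD :=
  ⟨fun k => if k ≤ -1 then
      let n : ℕ := (1 - k).toNat
      ((-1 : ℂ) ^ (n - 1) * (2 * ((n : ℂ) - 3) / n)) • der n f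
    else 0, -1, fun _ hk => if_neg (not_le.2 hk)⟩

/-- `θ₃(f∂) = ∑_{n ≥ 2} (-1)^n (3(n-1)/(n+1)) f⁽ⁿ⁺¹⁾ ξ^(-n)`. -/
def theta3 (f : Vect) : PsiD :=
  ⟨fun k => if k ≤ -2 then
      let n : ℕ := (-k).toNat
      ((-1 : ℂ) ^ n * (3 * ((n : ℂ) - 1) / ((n : ℂ) + 1))) • der (n + 1) f
    else 0, -2, fun _ hk => if_neg (not_le.2 hk)⟩

/-- The infinitesimal deformation `f∂ ↦ fξ + c₀θ₀ + c₁θ₁ + c₂θ₂ + c₃θ₃` in `ΨD(S¹)`. -/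
def infDef (c₀ c₁ c₂ c₃ : ℂ) (f : Vect) : PsiD :=
  stdEmbedding f + c₀ • theta0 f + c₁ • theta1 f + c₂ • theta2 f + c₃ • theta3 f

/-- The infinitesimal deformation in `ΨD_h(S¹)`: the cocycles are transported by `Φ_h⁻¹` and
rescaled so that they start with `f`, `f'`, `f'' ξ⁻¹` and `f''' ξ⁻²` again. -/
def infDefH (h : ℝ) (c₀ c₁ c₂ c₃ : ℂ) (f : Vect) : PsiD :=
  stdEmbedding f + c₀ • Phi h⁻¹ (theta0 f) + c₁ • Phi h⁻¹ (theta1 f) +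
    (c₂ * (h : ℂ)⁻¹) • Phi h⁻¹ (theta2 f) + (c₃ * (h : ℂ)⁻¹ ^ 2) • Phi h⁻¹ (theta3 f)

/-- The linear map `ρ` has the infinitesimal part `I`, where `I` is an infinitesimal deformation
with coefficient `c₀` at `θ₀`: up to terms in `ξ⁻³, ξ⁻⁴, …`, one has
`ρ(f∂) = I(f∂) + c₀ (a f' ξ⁻¹ + b f'' ξ⁻²)` with constants `a` and `b`. The terms `f` (of `θ₀`),
`f' ξ⁻¹` and `f'' ξ⁻²` have lower weight than the principal terms `f'`, `f'' ξ⁻¹`, `f''' ξ⁻²` of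
`θ₁`, `θ₂`, `θ₃`, where `f⁽ʲ⁾ ξ⁻ᵏ` has weight `j - k`. For `c₀ = 0` there is no correction; for
`c₀ ≠ 0` it cannot be avoided, because the commutator of the terms `c₀ f` and `c₂ g'' ξ⁻¹` has to be
compensated by a multiple of `c₀ c₂ f'' ξ⁻²`. -/
def HasInfinitesimalPart (ρ : Vect →ₗ[ℝ] PsiD) (c₀ : ℂ) (I : Vect → PsiD) : Prop :=
  ∃ a b : ℂ, ∀ f : Vect,
    OrderLE (ρ f - (I f + c₀ • (a • mono (-1) (der 1 f) + b • mono (-2) (der 2 f)))) (-3)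

/-- The infinitesimal deformation `I`, with coefficient `c₀` at `θ₀`, is the infinitesimal part
of a member of a polynomial deformation, for the Lie bracket `B` on symbols. -/
def ExtendsToPolynomialDeformation (B : PsiD → PsiD → PsiD) (c₀ : ℂ) (I : Vect → PsiD) : Prop :=
  ∃ (n : ℕ) (ρ : (Fin n → ℂ) → Vect →ₗ[ℝ] PsiD), IsPolynomialDeformation B ρ ∧
    ∃ t : Fin n → ℂ, HasInfinitesimalPart (ρ t) c₀ I

end PseudoDiff

end

/-!
Why the surface `P(c) = 0` of the theorem is the right one.

The factor `h` is harmless: if `ρ` is a homomorphism into `ΨD(S¹)`, then `h Φ_h⁻¹ ρ` is one into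
`ΨD_h(S¹)`, and this is a bijection. It replaces `cᵢ` by `cᵢ / hⁱ` (for `i ≥ 1`), and the polynomial
is quasi-homogeneous when `cᵢ` and `h` have the weights `i` and `1`; so everything happens at
`h = 1`.

*Sufficiency.* The maps `f ∂ ↦ f ξ + l f' + c f` are homomorphisms, and so are their conjugates by
`ξ^μ` for complex `μ` (`densityTwist_vectBracket`; the product of conjugated monomials is computed
with the Chu–Vandermonde identity in `coef_comp_twist`). This gives a deformation that is
polynomial in `(l, μ, c)`, with `c₁ = l + μ`, `c₂ = μ (μ - 1) / 2 + l μ` and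
`c₃ = μ (μ - 1) (μ - 2) / 6 + l μ (μ - 1) / 2`. Eliminating `l` leaves a quadratic and a cubic
equation for `μ`, whose resultant is a constant multiple of `P`: they have a common root exactly on
the surface (`exists_twist_parameter`).

*Necessity.* Only one member `σ = ρ(t)` of the deformation is needed. Filter symbols by their Taylor
expansion at a point: `xᵃ ξᵏ` has degree `a - k`, and products respect the filtration (`Fil.comp`),
the leading part of a product being determined by the leading parts of the factors (`lead_comp`).
If `f` vanishes to order `m + 1 ≤ 4`, then `σ f` has degree at least `m`, because terms of order at
most `-3` have degree at least `3` regardless of what they are. The lower order corrections with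
the factor `c₀` are of higher degree, too. Now the fields `x^(j+1) ∂` satisfy
`[e₁, e₂] = e₃`, `[e₁, e₃] = 2 e₄` and the relation `[e₁, e₄] = 3 [e₂, e₃]`, so the leading parts of
`σ e₁` and `σ e₂`, which involve just `c₁, c₂, c₃`, determine those of `σ e₃` and `σ e₄`, and the
constant term at `ξ⁻⁵` of the relation turns out to be `96 P(c) = 0`. On the circle `eⱼ` is
represented by `sin^(j+1) x ∂`: the last relation then holds exactly, and the errors in the first
two, `sin⁴ x (1 - cos x)` and `2 sin⁵ x (1 - cos x)`, are combinations of brackets which show that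
their images have higher degree (`fil_four`, `fil_five`). In this way no
locality or continuity of `σ` is needed.
-/

noncomputable section

namespace PseudoDiff

open Finset

/-! ### Functions on the circle -/

section Functions

variable {𝕜 : Type} [RCLike 𝕜]

theorem D_mul (f g : CircleFun 𝕜) : D (f * g) = D f * g + f * D g :=
  Subtype.ext <| funext fun _ =>
    deriv_mul ((contDiff_infty_iff_deriv.1 f.2.1).1 _) ((contDiff_infty_iff_deriv.1 g.2.1).1 _)

theorem iterate_D_eq_pow (n : ℕ) (u : CircleFun 𝕜) : D^[n] u = (D ^ n) u :=
  (Module.End.pow_apply D n u).symm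

theorem iterate_D_mul (n : ℕ) (u v : CircleFun 𝕜) :
    D^[n] (u * v) = ∑ x ∈ antidiagonal n, n.choose x.1 • (D^[x.1] u * D^[x.2] v) := by
  induction n with
  | zero => simp
  | succ n ih =>
    rw [sum_antidiagonal_choose_succ_nsmul (M := CircleFun 𝕜) (fun i j => D^[i] u * D^[j] v) n]
    simp only [Function.iterate_succ_apply', ih, map_sum, map_nsmul, D_mul, smul_add,
      sum_add_distrib]
    rw [add_comm]
    congr 1
    refine sum_congr rfl fun ⟨i, j⟩ hij ↦ ?_
    rw [n.choose_symm_of_eq_add (mem_antidiagonal.1 hij).symm]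

/-- The `n`-th derivative at the base point `0` of the circle. -/
def jet (n : ℕ) : CircleFun 𝕜 →ₗ[𝕜] 𝕜 where
  toFun u := (D^[n] u : CircleFun 𝕜).1 0
  map_add' u v := by rw [iterate_D_eq_pow, map_add]; simp [iterate_D_eq_pow]
  map_smul' a u := by rw [iterate_D_eq_pow, map_smul]; simp [iterate_D_eq_pow]

theorem jet_iterate_D (n k : ℕ) (u : CircleFun 𝕜) : jet n (D^[k] u) = jet (n + k) u := by
  change ((D^[n] (D^[k] u) : CircleFun 𝕜).1 0 : 𝕜) = (D^[n + k] u : CircleFun 𝕜).1 0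
  rw [Function.iterate_add_apply]

theorem jet_mul (n : ℕ) (u v : CircleFun 𝕜) :
    jet n (u * v) = ∑ x ∈ antidiagonal n, n.choose x.1 * (jet x.1 u * jet x.2 v) := by
  change ((D^[n] (u * v) : CircleFun 𝕜).1 0 : 𝕜) = _
  rw [iterate_D_mul, AddSubmonoidClass.coe_finsetSum, Finset.sum_apply]
  refine sum_congr rfl fun x _ => ?_
  rw [nsmul_eq_mul]
  rfl

end Functions

theorem toComplex_mul (f g : Vect) : toComplex (f * g) = toComplex f * toComplex g :=
  Subtype.ext <| funext fun _ => Complex.ofReal_mul _ _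

theorem D_toComplex (f : Vect) : D (toComplex f) = toComplex (D f) :=
  Subtype.ext <| funext fun x =>
    (((contDiff_infty_iff_deriv.1 f.2.1).1 x).hasDerivAt.ofReal_comp).deriv

theorem der_succ (n : ℕ) (f : Vect) : der (n + 1) f = D (der n f) :=
  Function.iterate_succ_apply' _ _ _

theorem der_eq_toComplex (n : ℕ) (f : Vect) : der n f = toComplex (D^[n] f) := by
  induction n with
  | zero => rfl
  | succ n ih => rw [der_succ, ih, D_toComplex, Function.iterate_succ_apply']

theorem iterate_D_der (n k : ℕ) (f : Vect) : D^[n] (der k f) = der (n + k) f :=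
  (Function.iterate_add_apply _ _ _ _).symm

theorem jet_der (n k : ℕ) (f : Vect) : jet n (der k f) = ((jet (n + k) f : ℝ) : ℂ) := by
  rw [← Nat.zero_add n]
  change jet (0 + n) (D^[k] (toComplex f)) = _
  rw [jet_iterate_D, Nat.zero_add, ← Nat.zero_add (n + k), ← jet_iterate_D]
  change jet 0 (der (n + k) f) = _
  rw [der_eq_toComplex, ← jet_iterate_D]
  rfl

theorem der_vectBracket (f g : Vect) :
    der 0 (vectBracket f g) = der 0 f * der 1 g - der 1 f * der 0 g := by
  simp only [der_eq_toComplex, vectBracket, ← toComplex_mul, ← map_sub]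
  rfl

/-! ### Coefficients of symbols -/

@[simp] theorem coef_add (F G : PsiD) (k : ℤ) : coef (F + G) k = coef F k + coef G k := rfl
@[simp] theorem coef_sub (F G : PsiD) (k : ℤ) : coef (F - G) k = coef F k - coef G k := rfl
@[simp] theorem coef_smul (a : ℂ) (F : PsiD) (k : ℤ) : coef (a • F) k = a • coef F k := rfl
@[simp] theorem coef_Phi (h : ℝ) (F : PsiD) (k : ℤ) :
    coef (Phi h F) k = ((h : ℂ) ^ k) • coef F k := rfl

theorem PsiD_ext {F G : PsiD} (h : ∀ k, coef F k = coef G k) : F = G :=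
  Subtype.ext (funext h)

theorem coef_mono (k j : ℤ) (u : CircleFun ℂ) : coef (mono k u) j = if j = k then u else 0 := by
  change (Pi.single k u : ℤ → CircleFun ℂ) j = _
  rw [Pi.single_apply]

theorem coef_comp_eq_sum {F G : PsiD} {m : ℤ} {S : Finset (ℤ × ℕ)}
    (hS : ∀ p, p ∉ S → compTerm F G m p = 0) :
    coef (comp F G) m = ∑ p ∈ S, compTerm F G m p := by
  refine finsum_eq_sum_of_support_subset _ fun p hp => ?_
  by_contra h
  exact hp (hS p h)

theorem exists_coef_comp_eq_sum (F G : PsiD) (m : ℤ) :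
    ∃ S : Finset (ℤ × ℕ), ∀ p, p ∉ S → compTerm F G m p = 0 :=
  ⟨(compTerm_support_finite F G m).toFinset, fun p hp => by
    by_contra h
    exact hp ((Set.Finite.mem_toFinset _).2 h)⟩

theorem comp_add_left (F F' G : PsiD) : comp (F + F') G = comp F G + comp F' G := by
  refine PsiD_ext fun m => ?_
  have h : ∀ p, compTerm (F + F') G m p = compTerm F G m p + compTerm F' G m p := fun p => by
    simp only [compTerm, coef_add, add_mul, smul_add]
  change ∑ᶠ p, compTerm (F + F') G m p = ∑ᶠ p, compTerm F G m p + ∑ᶠ p, compTerm F' G m p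
  simp only [h]
  exact finsum_add_distrib (compTerm_support_finite F G m) (compTerm_support_finite F' G m)

theorem comp_add_right (F G G' : PsiD) : comp F (G + G') = comp F G + comp F G' := by
  refine PsiD_ext fun m => ?_
  have h : ∀ p, compTerm F (G + G') m p = compTerm F G m p + compTerm F G' m p := fun p => by
    simp only [compTerm, coef_add, iterate_D_eq_pow, map_add, mul_add, smul_add]
  change ∑ᶠ p, compTerm F (G + G') m p = ∑ᶠ p, compTerm F G m p + ∑ᶠ p, compTerm F G' m p
  simp only [h]
  exact finsum_add_distrib (compTerm_support_finite F G m) (compTerm_support_finite F G' m)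

theorem comp_smul_left (a : ℂ) (F G : PsiD) : comp (a • F) G = a • comp F G := by
  refine PsiD_ext fun m => ?_
  have h : ∀ p, compTerm (a • F) G m p = a • compTerm F G m p := fun p => by
    simp only [compTerm, coef_smul, smul_mul_assoc]
    rw [smul_comm]
  change ∑ᶠ p, compTerm (a • F) G m p = a • ∑ᶠ p, compTerm F G m p
  simp only [h]
  exact (smul_finsum a _).symm

theorem comp_smul_right (a : ℂ) (F G : PsiD) : comp F (a • G) = a • comp F G := by
  refine PsiD_ext fun m => ?_
  have h : ∀ p, compTerm F (a • G) m p = a • compTerm F G m p := fun p => by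
    simp only [compTerm, coef_smul, iterate_D_eq_pow, map_smul, mul_smul_comm]
    rw [smul_comm]
  change ∑ᶠ p, compTerm F (a • G) m p = a • ∑ᶠ p, compTerm F G m p
  simp only [h]
  exact (smul_finsum a _).symm

theorem bracket_smul_smul (a : ℂ) (F G : PsiD) :
    bracket (a • F) (a • G) = (a * a) • bracket F G := by
  refine PsiD_ext fun k => ?_
  simp only [bracket, comp_smul_left, comp_smul_right, smul_smul, coef_sub, coef_smul, smul_sub]

theorem Phi_Phi_inv {h : ℝ} (hh : h ≠ 0) (F : PsiD) : Phi h (Phi h⁻¹ F) = F := by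
  simpa using Phi_inv_Phi (inv_ne_zero hh) F

theorem bracketH_eq (h : ℝ) (F G : PsiD) :
    bracketH h F G = ((h : ℂ)⁻¹) • Phi h⁻¹ (bracket (Phi h F) (Phi h G)) := by
  refine PsiD_ext fun k => ?_
  simp only [bracketH, compH, bracket, coef_sub, coef_smul, coef_Phi, smul_sub]

/-! ### Conjugation by complex powers of `ξ` -/

theorem OrderLE.comp {F G : PsiD} {N M : ℤ} (hF : OrderLE F N) (hG : OrderLE G M) :
    OrderLE (comp F G) (N + M) := fun m hm =>
  finsum_eq_zero_of_forall_eq_zero fun p =>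
    compTerm_eq_zero (N := N) (M := M) hF hG (by omega)

/-- The conjugate `ξ^μ ∘ u ξⁱ ∘ ξ^(-μ) = ∑ₙ (μ choose n) u⁽ⁿ⁾ ξ^(i-n)` for complex `μ`, defined by
this expansion. -/
def twist (μ : ℂ) (i : ℤ) (u : CircleFun ℂ) : PsiD :=
  ⟨fun m => if m ≤ i then Ring.choose μ (i - m).toNat • D^[(i - m).toNat] u else 0, i,
    fun _ hk => if_neg (not_le.2 hk)⟩

theorem coef_twist (μ : ℂ) (i m : ℤ) (u : CircleFun ℂ) : coef (twist μ i u) m =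
    if m ≤ i then Ring.choose μ (i - m).toNat • D^[(i - m).toNat] u else 0 := rfl

theorem orderLE_twist (μ : ℂ) (i : ℤ) (u : CircleFun ℂ) : OrderLE (twist μ i u) i :=
  fun _ hk => if_neg (not_le.2 hk)

theorem coef_twist_sub (μ : ℂ) (i : ℤ) (u : CircleFun ℂ) (n : ℕ) :
    coef (twist μ i u) (i - n) = Ring.choose μ n • D^[n] u := by
  rw [coef_twist, if_pos (by omega)]
  simp

theorem choose_smul_iterate_D_mul (μ : ℂ) (N : ℕ) (u v : CircleFun ℂ) :
    Ring.choose μ N • D^[N] (u * v) = ∑ x ∈ antidiagonal N,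
      (Ring.choose μ x.1 * Ring.choose (μ - x.1) x.2) • (D^[x.1] u * D^[x.2] v) := by
  rw [iterate_D_mul, smul_sum]
  refine sum_congr rfl fun x hx => ?_
  have hx' := mem_antidiagonal.1 hx
  have h := Ring.choose_smul_choose μ (n := N) (k := x.1) (by omega)
  rw [show N - x.1 = x.2 by omega] at h
  rw [← h, ← Nat.cast_smul_eq_nsmul ℂ, smul_smul, nsmul_eq_mul, mul_comm]

/-- The coefficients of a product of two twisted monomials; the inner sum over the expansion of the
product is evaluated by the Chu–Vandermonde identity. -/
theorem coef_comp_twist (μ : ℂ) (i j : ℤ) (u v : CircleFun ℂ) (N : ℕ) :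
    coef (comp (twist μ i u) (twist μ j v)) (i + j - N) = ∑ x ∈ antidiagonal N,
      (Ring.choose μ x.1 * Ring.choose (μ + i - x.1) x.2) • (D^[x.1] u * D^[x.2] v) := by
  have hS : ∀ p, p ∉ (range (N + 1)).image (fun a : ℕ => i - a) ×ˢ range (N + 1) →
      compTerm (twist μ i u) (twist μ j v) (i + j - N) p = 0 := by
    intro p hp
    refine compTerm_eq_zero (orderLE_twist μ i u) (orderLE_twist μ j v) ?_
    by_contra hc
    push Not at hc
    refine hp (mem_product.2 ⟨mem_image.2 ⟨(i - p.1).toNat, ?_, ?_⟩, ?_⟩)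
    · rw [mem_range]; omega
    · omega
    · rw [mem_range]; omega
  rw [coef_comp_eq_sum hS, sum_product, sum_image (fun a _ b _ h => by simpa using h),
    Nat.sum_antidiagonal_eq_sum_range_succ_mk]
  refine sum_congr rfl fun a ha => ?_
  have ha' : a ≤ N := Nat.lt_succ_iff.1 (mem_range.1 ha)
  have hV := Ring.add_choose_eq (N - a) (Commute.all ((i - a : ℤ) : ℂ) μ)
  rw [Nat.sum_antidiagonal_eq_sum_range_succ_mk] at hV
  have e : μ + i - a = ((i - a : ℤ) : ℂ) + μ := by push_cast; ring
  rw [e, hV, mul_sum, sum_smul, ← sum_subset (range_mono (show N - a + 1 ≤ N + 1 by omega))]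
  · refine sum_congr rfl fun k hk => ?_
    have hk' : k ≤ N - a := Nat.lt_succ_iff.1 (mem_range.1 hk)
    have e2 : i + j - N + k - (i - a) = j - ((N - a - k : ℕ) : ℤ) := by omega
    have e3 : D^[k] (D^[N - a - k] v) = D^[N - a] v := by
      rw [← Function.iterate_add_apply]
      congr 2
      omega
    change Ring.choose (i - a : ℤ) k • (coef (twist μ i u) (i - a) *
      D^[k] (coef (twist μ j v) (i + j - N + k - (i - a)))) = _
    rw [e2, coef_twist_sub, coef_twist_sub, iterate_D_eq_pow k, map_smul, ← iterate_D_eq_pow, e3,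
      ← Int.cast_smul_eq_zsmul ℂ, smul_mul_assoc, mul_smul_comm, smul_smul, smul_smul]
    congr 1
    have := Ring.map_choose (Int.castRingHom ℂ) (i - a) k
    simp only [eq_intCast] at this
    rw [this]
    ring
  · intro k hk hk'
    rw [mem_range] at hk hk'
    exact compTerm_eq_zero (orderLE_twist μ i u) (orderLE_twist μ j v)
      (Or.inr (by dsimp only; omega))

theorem comp_twist_zero (μ : ℂ) (j : ℤ) (u v : CircleFun ℂ) :
    comp (twist μ 0 u) (twist μ j v) = twist μ j (u * v) := by
  refine PsiD_ext fun m => ?_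
  rcases lt_or_ge j m with hm | hm
  · rw [(orderLE_twist μ 0 u).comp (orderLE_twist μ j v) m (by omega), orderLE_twist μ j _ m hm]
  · obtain ⟨N, rfl⟩ : ∃ N : ℕ, m = j - N := ⟨(j - m).toNat, by omega⟩
    have h := coef_comp_twist μ 0 j u v N
    rw [zero_add] at h
    rw [h, coef_twist_sub, choose_smul_iterate_D_mul]
    simp

theorem comp_twist_one (μ : ℂ) (j : ℤ) (u v : CircleFun ℂ) :
    comp (twist μ 1 u) (twist μ j v) = twist μ (1 + j) (u * v) + twist μ j (u * D v) := by
  refine PsiD_ext fun m => ?_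
  rw [coef_add]
  rcases lt_or_ge (1 + j) m with hm | hm
  · rw [(orderLE_twist μ 1 u).comp (orderLE_twist μ j v) m hm, orderLE_twist μ _ _ m hm,
      orderLE_twist μ _ _ m (by omega), add_zero]
  · obtain ⟨N, rfl⟩ : ∃ N : ℕ, m = 1 + j - N := ⟨(1 + j - m).toNat, by omega⟩
    rw [coef_comp_twist, coef_twist_sub]
    rcases N with _ | N
    · rw [orderLE_twist μ j _ _ (by push_cast; omega)]
      simp
    · rw [show 1 + j - ((N + 1 : ℕ) : ℤ) = j - N by push_cast; ring, coef_twist_sub,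
        choose_smul_iterate_D_mul, choose_smul_iterate_D_mul, Nat.sum_antidiagonal_succ',
        Nat.sum_antidiagonal_succ', add_assoc, ← sum_add_distrib]
      congr 1
      · simp
      · refine sum_congr rfl fun x _ => ?_
        rw [show μ + (1 : ℤ) - x.1 = (μ - x.1) + 1 by push_cast; ring, Ring.choose_succ_succ,
          mul_add, add_smul, add_comm, Function.iterate_succ_apply]

theorem twist_add (μ : ℂ) (i : ℤ) (u v : CircleFun ℂ) :
    twist μ i (u + v) = twist μ i u + twist μ i v := by
  refine PsiD_ext fun m => ?_
  rw [coef_add]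
  simp only [coef_twist, iterate_D_eq_pow, map_add]
  split_ifs <;> simp

theorem twist_smul (μ : ℂ) (i : ℤ) (a : ℂ) (u : CircleFun ℂ) :
    twist μ i (a • u) = a • twist μ i u := by
  refine PsiD_ext fun m => ?_
  rw [coef_smul]
  simp only [coef_twist, iterate_D_eq_pow, map_smul]
  split_ifs <;> simp [smul_comm a]

theorem twist_sub (μ : ℂ) (i : ℤ) (u v : CircleFun ℂ) :
    twist μ i (u - v) = twist μ i u - twist μ i v := by
  refine PsiD_ext fun m => ?_
  rw [coef_sub]
  simp only [coef_twist, iterate_D_eq_pow, map_sub]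
  split_ifs <;> simp [smul_sub]

/-- The action `f ∂ ↦ f (ξ + c) + l f'` on densities of weight `l`, shifted by `c` and conjugated by
`ξ^μ`. -/
def densityTwist (l μ c : ℂ) : Vect →ₗ[ℝ] PsiD where
  toFun f := twist μ 1 (der 0 f) + twist μ 0 (l • der 1 f + c • der 0 f)
  map_add' f g := by
    have h : ∀ n, der n (f + g) = der n f + der n g := fun n => by
      simp only [der, iterate_D_eq_pow, map_add]
    simp only [h, twist_add, smul_add]
    abel
  map_smul' a f := by
    have h : ∀ n, der n (a • f) = (a : ℂ) • der n f := fun n => by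
      have : toComplex (a • f) = (a : ℂ) • toComplex f := by rw [map_smul]; rfl
      simp only [der, iterate_D_eq_pow, map_smul, this]
    simp only [h, smul_comm _ (a : ℂ), ← smul_add, twist_smul]
    rfl

theorem densityTwist_apply (l μ c : ℂ) (f : Vect) : densityTwist l μ c f =
    twist μ 1 (der 0 f) + twist μ 0 (l • der 1 f + c • der 0 f) := rfl

theorem densityTwist_vectBracket (l μ c : ℂ) (f g : Vect) :
    densityTwist l μ c (vectBracket f g) =
      bracket (densityTwist l μ c f) (densityTwist l μ c g) := by
  have h1 : der 1 (vectBracket f g) = der 0 f * der 2 g - der 2 f * der 0 g := by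
    rw [der_succ, der_vectBracket, map_sub, D_mul, D_mul, ← der_succ, ← der_succ, ← der_succ,
      ← der_succ]
    ring
  simp only [bracket, densityTwist_apply, comp_add_left, comp_add_right, comp_twist_one,
    comp_twist_zero, h1, der_vectBracket, map_add, map_smul, ← der_succ]
  refine PsiD_ext fun k => ?_
  have key : ∀ i : ℤ, ∀ u v : CircleFun ℂ, coef (twist μ i (u + v)) k =
      coef (twist μ i u) k + coef (twist μ i v) k := fun i u v => by rw [twist_add, coef_add]
  have key' : ∀ i : ℤ, ∀ u v : CircleFun ℂ, coef (twist μ i (u - v)) k =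
      coef (twist μ i u) k - coef (twist μ i v) k := fun i u v => by rw [twist_sub, coef_sub]
  have key2 : ∀ i : ℤ, ∀ (a : ℂ) (u : CircleFun ℂ), coef (twist μ i (a • u)) k =
      a • coef (twist μ i u) k := fun i a u => by rw [twist_smul, coef_smul]
  have hc : ∀ a b, der a g * der b f = der b f * der a g := fun a b => mul_comm _ _
  simp only [coef_add, coef_sub, mul_add, add_mul, mul_smul_comm, smul_mul_assoc, key, key', key2,
    smul_sub, smul_add, zero_add, add_zero, one_add_one_eq_two, hc, smul_comm c l]
  abel

/-! ### Coefficients of the infinitesimal deformations -/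

theorem coef_stdEmbedding (f : Vect) (k : ℤ) :
    coef (stdEmbedding f) k = if k = 1 then der 0 f else 0 := coef_mono _ _ _

theorem coef_theta0 (f : Vect) (k : ℤ) :
    coef (theta0 f) k = if k = 0 then der 0 f else 0 := coef_mono _ _ _

theorem coef_theta1 (f : Vect) (k : ℤ) :
    coef (theta1 f) k = if k = 0 then der 1 f else 0 := coef_mono _ _ _

theorem coef_theta2 (f : Vect) (k : ℤ) : coef (theta2 f) k = if k ≤ -1 then
    ((-1 : ℂ) ^ ((1 - k).toNat - 1) * (2 * (((1 - k).toNat : ℂ) - 3) / ((1 - k).toNat : ℂ))) •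
      der (1 - k).toNat f else 0 := rfl

theorem coef_theta3 (f : Vect) (k : ℤ) : coef (theta3 f) k = if k ≤ -2 then
    ((-1 : ℂ) ^ (-k).toNat * (3 * (((-k).toNat : ℂ) - 1) / (((-k).toNat : ℂ) + 1))) •
      der ((-k).toNat + 1) f else 0 := rfl

section

variable {h : ℝ} (c₀ c₁ c₂ c₃ : ℂ) (f : Vect)

theorem coef_infDefH_one : coef (infDefH h c₀ c₁ c₂ c₃ f) 1 = der 0 f := by
  simp [infDefH, coef_stdEmbedding, coef_theta0, coef_theta1, coef_theta2, coef_theta3]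

theorem coef_infDefH_zero :
    coef (infDefH h c₀ c₁ c₂ c₃ f) 0 = c₀ • der 0 f + c₁ • der 1 f := by
  simp [infDefH, coef_stdEmbedding, coef_theta0, coef_theta1, coef_theta2, coef_theta3]

theorem coef_infDefH_neg_one (hh : h ≠ 0) : coef (infDefH h c₀ c₁ c₂ c₃ f) (-1) = c₂ • der 2 f := by
  have h0 : (h : ℂ) ≠ 0 := by exact_mod_cast hh
  simp [infDefH, coef_stdEmbedding, coef_theta0, coef_theta1, coef_theta2, coef_theta3, smul_smul]
  congr 1
  field_simp
  norm_num

theorem coef_infDefH_neg_two (hh : h ≠ 0) : coef (infDefH h c₀ c₁ c₂ c₃ f) (-2) = c₃ • der 3 f := by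
  have h0 : (h : ℂ) ≠ 0 := by exact_mod_cast hh
  simp [infDefH, coef_stdEmbedding, coef_theta0, coef_theta1, coef_theta2, coef_theta3, smul_smul]
  congr 1
  field_simp
  norm_num

theorem orderLE_infDefH : OrderLE (infDefH h c₀ c₁ c₂ c₃ f) 1 := by
  intro k hk
  simp [infDefH, coef_stdEmbedding, coef_theta0, coef_theta1, coef_theta2, coef_theta3,
    show k ≠ 1 by omega, show k ≠ 0 by omega, show ¬ k ≤ -1 by omega, show ¬ k ≤ -2 by omega]

end

/-! ### Polynomial families -/

theorem IsPolynomialFamily.add {n : ℕ} {T T' : (Fin n → ℂ) → Vect → CircleFun ℂ}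
    (hT : IsPolynomialFamily T) (hT' : IsPolynomialFamily T') :
    IsPolynomialFamily fun c f => T c f + T' c f := by
  classical
  obtain ⟨S, A, hA⟩ := hT
  obtain ⟨S', A', hA'⟩ := hT'
  refine ⟨S ∪ S', fun α => (if α ∈ S then A α else 0) + if α ∈ S' then A' α else 0,
    fun c f => ?_⟩
  dsimp only
  rw [hA, hA', sum_subset_zero_on_sdiff (g := fun α => (∏ i, c i ^ α i) •
      (if α ∈ S then A α else 0) f) (subset_union_left (s₁ := S) (s₂ := S')),
    sum_subset_zero_on_sdiff (s₁ := S') (g := fun α => (∏ i, c i ^ α i) •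
      (if α ∈ S' then A' α else 0) f) (subset_union_right (s₁ := S) (s₂ := S')),
    ← sum_add_distrib]
  · simp [smul_add]
  · intro x hx
    simp [(mem_sdiff.1 hx).2]
  · intro x hx
    simp [hx]
  · intro x hx
    simp [(mem_sdiff.1 hx).2]
  · intro x hx
    simp [hx]

theorem isPolynomialFamily_eval_smul {n : ℕ} (p : MvPolynomial (Fin n) ℂ)
    (B : Vect →ₗ[ℝ] CircleFun ℂ) :
    IsPolynomialFamily fun c f => MvPolynomial.eval c p • B f := by
  refine ⟨p.support.map Finsupp.equivFunOnFinite.toEmbedding,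
    fun α => p.coeff (Finsupp.equivFunOnFinite.symm α) • B, fun c f => ?_⟩
  dsimp only
  rw [MvPolynomial.eval_eq', sum_smul, sum_map]
  refine sum_congr rfl fun α _ => ?_
  simp [smul_smul, mul_comm]

/-- The linear map `f ∂ ↦ f⁽ⁿ⁾`. -/
def derLinear (n : ℕ) : Vect →ₗ[ℝ] CircleFun ℂ :=
  ((D ^ n : Module.End ℂ (CircleFun ℂ)).restrictScalars ℝ).comp toComplex

theorem derLinear_apply (n : ℕ) (f : Vect) : derLinear n f = der n f :=
  (iterate_D_eq_pow n _).symm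

theorem exists_eval_eq_choose {n : ℕ} (i : Fin n) (k : ℕ) :
    ∃ p : MvPolynomial (Fin n) ℂ, ∀ c, MvPolynomial.eval c p = Ring.choose (c i) k := by
  refine ⟨MvPolynomial.C (k.factorial : ℂ)⁻¹ *
    Polynomial.aeval (MvPolynomial.X i) (descPochhammer ℤ k), fun c => ?_⟩
  rw [Ring.choose_eq_smul, map_mul, MvPolynomial.eval_C, smul_eq_mul,
    ← Polynomial.aeval_eq_smeval]
  congr 1
  have := Polynomial.map_aeval_eq_aeval_map (φ := RingHom.id ℤ) (ψ := MvPolynomial.eval c)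
    (RingHom.ext_int _ _) (descPochhammer ℤ k) (MvPolynomial.X i)
  simpa using this

/-! ### The three-parameter family of deformations -/

/-- `(l, μ, c) ↦ h Φ_h⁻¹ (densityTwist l μ c)`, with values in `ΨD_h(S¹)`. -/
def densityFamily (h : ℝ) (t : Fin 3 → ℂ) : Vect →ₗ[ℝ] PsiD :=
  (((h : ℂ) • Phi h⁻¹).restrictScalars ℝ).comp (densityTwist (t 0) (t 1) (t 2))

theorem densityFamily_apply (h : ℝ) (t : Fin 3 → ℂ) (f : Vect) :
    densityFamily h t f = (h : ℂ) • Phi h⁻¹ (densityTwist (t 0) (t 1) (t 2) f) := rfl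

theorem coef_densityFamily (h : ℝ) (t : Fin 3 → ℂ) (f : Vect) (k : ℤ) :
    coef (densityFamily h t f) k = ((h : ℂ) * ((h⁻¹ : ℝ) : ℂ) ^ k) •
      ((if k ≤ 1 then Ring.choose (t 1) (1 - k).toNat • der (1 - k).toNat f else 0) +
        if k ≤ 0 then Ring.choose (t 1) (0 - k).toNat •
          (t 0 • der ((0 - k).toNat + 1) f + t 2 • der (0 - k).toNat f) else 0) := by
  rw [densityFamily_apply, densityTwist_apply, coef_smul, coef_Phi, smul_smul, coef_add,
    coef_twist, coef_twist, iterate_D_der, iterate_D_eq_pow, map_add, map_smul, map_smul,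
    ← iterate_D_eq_pow, ← iterate_D_eq_pow, iterate_D_der, iterate_D_der, add_zero, add_zero]

theorem isPolynomialDeformation_densityFamily {h : ℝ} (hh : h ≠ 0) :
    IsPolynomialDeformation (bracketH h) (densityFamily h) where
  hom t f g := by
    have h0 : (h : ℂ) ≠ 0 := by exact_mod_cast hh
    rw [bracketH_eq, densityFamily_apply, densityFamily_apply, densityFamily_apply, map_smul,
      map_smul, Phi_Phi_inv hh, Phi_Phi_inv hh, bracket_smul_smul, map_smul,
      densityTwist_vectBracket, smul_smul]
    congr 1
    field_simp
  at_zero f := by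
    have h0 : (h : ℂ) ≠ 0 := by exact_mod_cast hh
    refine PsiD_ext fun k => ?_
    rw [coef_densityFamily, coef_stdEmbedding]
    rcases lt_trichotomy k 1 with hk | rfl | hk
    · obtain ⟨n, hn⟩ : ∃ n, (1 - k).toNat = n + 1 := ⟨(1 - k).toNat - 1, by omega⟩
      simp [hn, hk.ne, Ring.choose_zero_succ]
    · simp [h0]
    · simp [show ¬ k ≤ 1 by omega, show ¬ k ≤ 0 by omega, hk.ne']
  polynomial k := by
    obtain ⟨p, hp⟩ := exists_eval_eq_choose (1 : Fin 3) (1 - k).toNat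
    obtain ⟨q, hq⟩ := exists_eval_eq_choose (1 : Fin 3) (0 - k).toNat
    have key := ((isPolynomialFamily_eval_smul
      (MvPolynomial.C (if k ≤ 1 then (h : ℂ) * ((h⁻¹ : ℝ) : ℂ) ^ k else 0) * p)
        (derLinear (1 - k).toNat)).add (isPolynomialFamily_eval_smul
      (MvPolynomial.C (if k ≤ 0 then (h : ℂ) * ((h⁻¹ : ℝ) : ℂ) ^ k else 0) * q *
        MvPolynomial.X 0) (derLinear ((0 - k).toNat + 1)))).add (isPolynomialFamily_eval_smul
      (MvPolynomial.C (if k ≤ 0 then (h : ℂ) * ((h⁻¹ : ℝ) : ℂ) ^ k else 0) * q *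
        MvPolynomial.X 2) (derLinear (0 - k).toNat))
    convert key using 3 with t f
    rw [coef_densityFamily]
    simp only [map_mul, MvPolynomial.eval_C, MvPolynomial.eval_X, hp, hq, derLinear_apply]
    split_ifs <;> simp [smul_smul, mul_assoc, add_assoc]
  bounded := ⟨1, fun t f k hk => by
    rw [coef_densityFamily]
    simp [show ¬ k ≤ 1 by omega, show ¬ k ≤ 0 by omega]⟩

theorem choose_two (a : ℂ) : Ring.choose a 2 = a * (a - 1) / 2 := by
  rw [Ring.choose_eq_smul, ← Polynomial.aeval_eq_smeval]
  simp [descPochhammer_succ_right]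
  ring

theorem choose_three (a : ℂ) : Ring.choose a 3 = a * (a - 1) * (a - 2) / 6 := by
  rw [Ring.choose_eq_smul, ← Polynomial.aeval_eq_smeval]
  simp [descPochhammer_succ_right, Nat.factorial, map_ofNat]
  ring

/-- Up to a constant factor, the obstruction polynomial is the resultant in `m` of the two equations
below, that is, the product of the values of the second one at the two roots of the first one. -/
theorem exists_twist_parameter {k₁ k₂ k₃ : ℂ}
    (hP : 6 * k₁ ^ 3 * k₃ - 3 * k₁ ^ 2 * k₂ ^ 2 - 18 * k₁ * k₂ * k₃ + 8 * k₂ ^ 3 + 9 * k₃ ^ 2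
      + 3 * k₁ ^ 3 * k₂ - 6 * k₁ * k₂ ^ 2 - 9 * k₁ ^ 2 * k₃ + 18 * k₂ * k₃
      + 3 * k₁ * k₃ - 5 * k₁ ^ 2 * k₂ + 8 * k₂ ^ 2 + 2 * k₁ * k₂ = 0) :
    ∃ m : ℂ, m * (2 * k₁ - m - 1) / 2 = k₂ ∧ m * (m - 1) * (3 * k₁ - 2 * m - 2) / 6 = k₃ := by
  -- the roots of the quadratic are `k₁ - 1/2 ± s`
  obtain ⟨s, hs⟩ := IsAlgClosed.exists_pow_nat_eq ((k₁ - 1 / 2) ^ 2 - 2 * k₂) (n := 2) two_pos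
  have hk : k₂ = ((k₁ - 1 / 2) ^ 2 - s ^ 2) / 2 := by linear_combination hs / 2
  have hprod : ((k₁ - 1 / 2 + s) * (k₁ - 1 / 2 + s - 1) * (3 * k₁ - 2 * (k₁ - 1 / 2 + s) - 2) / 6
      - k₃) * ((k₁ - 1 / 2 - s) * (k₁ - 1 / 2 - s - 1) * (3 * k₁ - 2 * (k₁ - 1 / 2 - s) - 2) / 6
      - k₃) = 0 := by
    subst hk
    linear_combination hP / 9
  rcases mul_eq_zero.1 hprod with h | h
  · exact ⟨_, by rw [hk]; ring, sub_eq_zero.1 h⟩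
  · exact ⟨_, by rw [hk]; ring, sub_eq_zero.1 h⟩

theorem extends_of_eq_zero {h : ℝ} (hh : h ≠ 0) {c₀ c₁ c₂ c₃ : ℂ}
    (hP : (6 * c₁ ^ 3 * c₃ - 3 * c₁ ^ 2 * c₂ ^ 2 - 18 * c₁ * c₂ * c₃ + 8 * c₂ ^ 3 + 9 * c₃ ^ 2)
      + (h : ℂ) * (3 * c₁ ^ 3 * c₂ - 6 * c₁ * c₂ ^ 2 - 9 * c₁ ^ 2 * c₃ + 18 * c₂ * c₃)
      + (h : ℂ) ^ 2 * (3 * c₁ * c₃ - 5 * c₁ ^ 2 * c₂ + 8 * c₂ ^ 2)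
      + (h : ℂ) ^ 3 * (2 * c₁ * c₂) = 0) :
    ExtendsToPolynomialDeformation (bracketH h) c₀ (infDefH h c₀ c₁ c₂ c₃) := by
  have h0 : (h : ℂ) ≠ 0 := by exact_mod_cast hh
  obtain ⟨m, h2, h3⟩ := exists_twist_parameter (k₁ := c₁ / h) (k₂ := c₂ / h ^ 2)
    (k₃ := c₃ / h ^ 3) (by field_simp; linear_combination hP)
  rw [eq_div_iff (by positivity)] at h2 h3
  refine ⟨3, densityFamily h, isPolynomialDeformation_densityFamily hh,
    ![c₁ / h - m, m, c₀ / h], h * m, h ^ 2 * (m * (m - 1) / 2), fun f k hk => ?_⟩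
  rw [coef_sub, sub_eq_zero, coef_add, coef_smul, coef_add, coef_smul, coef_smul, coef_mono,
    coef_mono, coef_densityFamily]
  rcases lt_or_ge 1 k with h1 | h1
  · rw [orderLE_infDefH c₀ c₁ c₂ c₃ f k h1]
    simp [show ¬ k ≤ 1 by omega, show ¬ k ≤ 0 by omega, show k ≠ -1 by omega,
      show k ≠ -2 by omega]
  · obtain rfl | rfl | rfl | rfl : k = 1 ∨ k = 0 ∨ k = -1 ∨ k = -2 := by omega
    · rw [coef_infDefH_one]
      simp [h0]
    · rw [coef_infDefH_zero]
      simp [← add_assoc, ← add_smul]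
      match_scalars <;> field_simp <;> exact mul_comm _ _
    · rw [coef_infDefH_neg_one _ _ _ _ _ hh]
      simp [choose_two, zpow_neg]
      rw [← h2]
      match_scalars <;> field_simp
      ring
    · rw [coef_infDefH_neg_two _ _ _ _ _ hh]
      simp [choose_two, choose_three, zpow_neg]
      rw [← h3]
      match_scalars <;> field_simp
      ring

/-! ### The filtration by vanishing order at a point -/

/-- `Fil d F`: at the base point `0`, only monomials `xᵃ ξᵏ` with `a - k ≥ d` occur in the Taylor
expansion of the symbol `F`. -/
def Fil (d : ℤ) (F : PsiD) : Prop :=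
  ∀ (k : ℤ) (a : ℕ), (a : ℤ) - k < d → jet a (coef F k) = 0

/-- The part of degree `d` of a symbol at the base point: `lead d F a / a!` is the coefficient of
the monomial `xᵃ ξ^(a-d)`. -/
def lead (d : ℤ) (F : PsiD) (a : ℕ) : ℂ := jet a (coef F (a - d))

theorem Fil.anti {d d' : ℤ} {F : PsiD} (h : Fil d F) (hd : d' ≤ d) : Fil d' F :=
  fun k a hka => h k a (hka.trans_le hd)

theorem Fil.add {d : ℤ} {F G : PsiD} (hF : Fil d F) (hG : Fil d G) : Fil d (F + G) :=
  fun k a hka => by rw [coef_add, map_add, hF k a hka, hG k a hka, add_zero]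

theorem Fil.sub {d : ℤ} {F G : PsiD} (hF : Fil d F) (hG : Fil d G) : Fil d (F - G) :=
  fun k a hka => by rw [coef_sub, map_sub, hF k a hka, hG k a hka, sub_zero]

theorem Fil.lead_eq_zero {d e : ℤ} {F : PsiD} (hF : Fil d F) (h : e < d) (a : ℕ) :
    lead e F a = 0 := hF _ _ (by omega)

theorem OrderLE.lead_eq_zero {d N : ℤ} {F : PsiD} (hF : OrderLE F N) {a : ℕ} (h : N < a - d) :
    lead d F a = 0 := by
  rw [lead, hF _ h, map_zero]

@[simp] theorem lead_add (d : ℤ) (F G : PsiD) (a : ℕ) :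
    lead d (F + G) a = lead d F a + lead d G a := by
  simp [lead]

@[simp] theorem lead_sub (d : ℤ) (F G : PsiD) (a : ℕ) :
    lead d (F - G) a = lead d F a - lead d G a := by
  simp [lead]

theorem jet_compTerm (F G : PsiD) (m : ℤ) (p : ℤ × ℕ) (n : ℕ) :
    jet n (compTerm F G m p) = ∑ x ∈ antidiagonal n,
      ((Ring.choose p.1 p.2 : ℤ) : ℂ) * (n.choose x.1 *
        (jet x.1 (coef F p.1) * jet (x.2 + p.2) (coef G (m + p.2 - p.1)))) := by
  rw [compTerm, ← Int.cast_smul_eq_zsmul ℂ, map_smul, jet_mul, smul_eq_mul, mul_sum]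
  simp only [jet_iterate_D]

theorem Fil.comp {d e : ℤ} {F G : PsiD} (hF : Fil d F) (hG : Fil e G) :
    Fil (d + e) (comp F G) := by
  intro m n hmn
  obtain ⟨S, hS⟩ := exists_coef_comp_eq_sum F G m
  rw [coef_comp_eq_sum hS, map_sum]
  refine sum_eq_zero fun p _ => ?_
  rw [jet_compTerm]
  refine sum_eq_zero fun x hx => ?_
  have hx' := mem_antidiagonal.1 hx
  rcases lt_or_ge ((x.1 : ℤ) - p.1) d with h | h
  · rw [hF _ _ h]; simp
  · rw [hG _ _ (by push_cast; omega)]; simp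

theorem Fil.bracket {d e : ℤ} {F G : PsiD} (hF : Fil d F) (hG : Fil e G) :
    Fil (d + e) (bracket F G) :=
  (hF.comp hG).sub (by rw [add_comm]; exact hG.comp hF)

/-- The leading part of a product depends only on the leading parts of the factors: it is their
product in the Weyl algebra extended by negative powers of `ξ`. -/
theorem lead_comp {F G : PsiD} {N M d e : ℤ} (hFo : OrderLE F N) (hGo : OrderLE G M)
    (hF : Fil d F) (hG : Fil e G) (n K : ℕ) (hK : N + M + d + e - n < K) :
    lead (d + e) (comp F G) n = ∑ x ∈ antidiagonal n, n.choose x.1 * (lead d F x.1 *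
      ∑ k ∈ range K, ((Ring.choose ((x.1 : ℤ) - d) k : ℤ) : ℂ) * lead e G (x.2 + k)) := by
  set m : ℤ := n - (d + e) with hm
  set T : Finset ℤ := Icc (m - M) N ∪ Icc (-d) (n - d) with hT
  have hS : ∀ p, p ∉ T ×ˢ range K → compTerm F G m p = 0 := by
    intro p hp
    refine compTerm_eq_zero hFo hGo ?_
    by_contra hc
    refine hp ?_
    simp only [hT, mem_product, mem_union, mem_Icc, mem_range]
    omega
  rw [lead, ← hm, coef_comp_eq_sum hS, map_sum]
  simp only [jet_compTerm]
  rw [sum_comm]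
  refine sum_congr rfl fun x hx => ?_
  have hx' := mem_antidiagonal.1 hx
  rw [sum_product_right, mul_sum, mul_sum]
  refine sum_congr rfl fun k _ => ?_
  -- for `i < x.1 - d` the second factor vanishes, for `i > x.1 - d` the first one
  rw [sum_eq_single ((x.1 : ℤ) - d)]
  · have e1 : m + k - ((x.1 : ℤ) - d) = ((x.2 + k : ℕ) : ℤ) - e := by push_cast; omega
    dsimp only
    rw [e1, lead, lead]
    ring
  · intro i _ hi
    dsimp only
    rcases lt_or_gt_of_ne hi with h | h
    · rw [hG _ _ (by push_cast; omega)]; simp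
    · rw [hF _ _ (by omega)]; simp
  · intro h
    refine absurd ?_ h
    simp only [hT, mem_union, mem_Icc]
    omega

/-- The leading part of a commutator of symbols of order at most one. -/
theorem lead_bracket {F G : PsiD} {d e : ℤ} (hFo : OrderLE F 1) (hGo : OrderLE G 1)
    (hF : Fil d F) (hG : Fil e G) (n K : ℕ) (hK : 2 + d + e - n < K) :
    lead (d + e) (bracket F G) n =
      (∑ x ∈ antidiagonal n, n.choose x.1 * (lead d F x.1 *
        ∑ k ∈ range K, ((Ring.choose ((x.1 : ℤ) - d) k : ℤ) : ℂ) * lead e G (x.2 + k))) -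
      ∑ x ∈ antidiagonal n, n.choose x.1 * (lead e G x.1 *
        ∑ k ∈ range K, ((Ring.choose ((x.1 : ℤ) - e) k : ℤ) : ℂ) * lead d F (x.2 + k)) := by
  rw [bracket, lead_sub, lead_comp hFo hGo hF hG n K (by omega), add_comm d e,
    lead_comp hGo hFo hG hF n K (by omega)]

/-! ### Trigonometric vector fields -/

/-- The function `sin x` on the circle. -/
def sinFun : Vect := ⟨Real.sin, Real.contDiff_sin, Real.sin_periodic⟩

/-- The function `cos x` on the circle. -/
def cosFun : Vect := ⟨Real.cos, Real.contDiff_cos, Real.cos_periodic⟩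

theorem D_sinFun : D sinFun = cosFun := Subtype.ext Real.deriv_sin

theorem D_cosFun : D cosFun = -sinFun := Subtype.ext <| funext fun _ => Real.deriv_cos

theorem D_one : D (1 : Vect) = 0 := Subtype.ext <| funext fun _ => deriv_const _ _

theorem D_pow_succ (f : Vect) (n : ℕ) : D (f ^ (n + 1)) = (n + 1 : ℕ) • (f ^ n * D f) := by
  induction n with
  | zero => simp
  | succ n ih =>
    rw [pow_succ, D_mul, ih]
    simp only [nsmul_eq_mul]
    push_cast
    ring

/-- `f` vanishes at the base point to order at least `m`. -/
def VanishesToOrder (m : ℕ) (f : Vect) : Prop := ∀ n < m, jet n f = 0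

theorem VanishesToOrder.mul {m n : ℕ} {f g : Vect} (hf : VanishesToOrder m f)
    (hg : VanishesToOrder n g) : VanishesToOrder (m + n) (f * g) := by
  intro k hk
  rw [jet_mul]
  refine sum_eq_zero fun x hx => ?_
  have hx' := mem_antidiagonal.1 hx
  rcases lt_or_ge x.1 m with h | h
  · rw [hf _ h]; simp
  · rw [hg _ (by omega)]; simp

theorem VanishesToOrder.pow {m : ℕ} {f : Vect} (hf : VanishesToOrder m f) (n : ℕ) :
    VanishesToOrder (n * m) (f ^ n) := by
  induction n with
  | zero => intro k hk; omega
  | succ n ih => rw [pow_succ, Nat.succ_mul]; exact ih.mul hf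

theorem VanishesToOrder.mono {m n : ℕ} {f : Vect} (hf : VanishesToOrder m f) (h : n ≤ m) :
    VanishesToOrder n f := fun k hk => hf k (hk.trans_le h)

theorem vanishesToOrder_sinFun : VanishesToOrder 1 sinFun := by
  intro n hn
  obtain rfl : n = 0 := by omega
  exact Real.sin_zero

theorem vanishesToOrder_one_sub_cosFun : VanishesToOrder 2 (1 - cosFun) := by
  intro n hn
  interval_cases n
  · change (1 : ℝ) - Real.cos 0 = 0
    simp
  · change (D (1 - cosFun) : CircleFun ℝ).1 0 = 0
    rw [map_sub, D_cosFun, D_one, sub_neg_eq_add, zero_add]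
    exact Real.sin_zero

theorem jet_two_sinFun_sq : jet 2 (sinFun ^ 2) = 2 := by
  change ((D (D (sinFun ^ 2)) : CircleFun ℝ).1 0 : ℝ) = 2
  have : D (D (sinFun ^ 2)) = 2 * cosFun * cosFun - 2 * sinFun * sinFun := by
    rw [D_pow_succ, map_nsmul, D_mul, D_sinFun, pow_one, D_cosFun, D_sinFun, nsmul_eq_mul]
    push_cast
    ring
  rw [this]
  change 2 * Real.cos 0 * Real.cos 0 - 2 * Real.sin 0 * Real.sin 0 = 2
  simp

theorem jet_three_sinFun_cube : jet 3 (sinFun ^ 3) = 6 := by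
  have h := jet_mul 3 (sinFun ^ 2) sinFun
  have h1 : jet 1 sinFun = 1 := by
    change ((D sinFun : CircleFun ℝ).1 0 : ℝ) = 1
    rw [D_sinFun]
    exact Real.cos_zero
  have h0 := vanishesToOrder_sinFun
  have h2 := vanishesToOrder_sinFun.pow 2
  rw [← pow_succ] at h
  rw [h]
  simp [Nat.antidiagonal_succ, h0 0, h1, h2 0, h2 1, jet_two_sinFun_sq]
  norm_num

theorem vectBracket_pow (m n : ℕ) : vectBracket (sinFun ^ (m + 1)) (sinFun ^ (n + 1)) =
    ((n : Vect) - m) * (sinFun ^ (m + n + 1) * cosFun) := by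
  simp only [vectBracket, D_pow_succ, D_sinFun, nsmul_eq_mul]
  push_cast
  ring

/-- A way to write a product as a difference of two brackets. -/
theorem vectBracket_mul_sub (u v f : Vect) :
    vectBracket u (f * v) - vectBracket (u * v) f = 2 * (u * D v * f) := by
  simp only [vectBracket, D_mul]
  ring

/-! ### The obstruction to a homomorphism with given principal part -/

/-- A real-linear map `f ∂ ↦ f ξ + k₀ f + k₁ f' + (k₂ f'' + a f') ξ⁻¹ + (k₃ f''' + b f'') ξ⁻² + ⋯`
that respects brackets. -/
structure IsHomWithPart (σ : Vect →ₗ[ℝ] PsiD) (k₀ k₁ k₂ k₃ a b : ℂ) : Prop where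
  hom : ∀ f g, σ (vectBracket f g) = bracket (σ f) (σ g)
  orderLE : ∀ f, OrderLE (σ f) 1
  coef_one : ∀ f, coef (σ f) 1 = der 0 f
  coef_zero : ∀ f, coef (σ f) 0 = k₀ • der 0 f + k₁ • der 1 f
  coef_neg_one : ∀ f, coef (σ f) (-1) = k₂ • der 2 f + a • der 1 f
  coef_neg_two : ∀ f, coef (σ f) (-2) = k₃ • der 3 f + b • der 2 f

/-- `map_sub`, with the subtraction that instance search finds on the subtype of symbols. -/
theorem linearMap_sub (σ : Vect →ₗ[ℝ] PsiD) (f g : Vect) : σ (f - g) = σ f - σ g := map_sub σ f g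

theorem linearMap_two_mul (σ : Vect →ₗ[ℝ] PsiD) (f : Vect) : σ (2 * f) = σ f + σ f := by
  rw [two_mul, map_add]

theorem fil_of_two_mul {σ : Vect →ₗ[ℝ] PsiD} {d : ℤ} {f : Vect} (h : Fil d (σ (2 * f))) :
    Fil d (σ f) := by
  intro k n hkn
  have := h k n hkn
  rw [linearMap_two_mul, coef_add, map_add, ← two_mul] at this
  simpa using this

theorem cast_choose_eq (z : ℤ) (k : ℕ) :
    ((Ring.choose z k : ℤ) : ℂ) = (∏ i ∈ range k, ((z : ℂ) - i)) / k.factorial := by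
  have := Ring.map_choose (Int.castRingHom ℂ) z k
  simp only [eq_intCast] at this
  rw [this, Ring.choose_eq_smul, ← Polynomial.aeval_eq_smeval, ← descPochhammer_eval_eq_prod_range,
    smul_eq_mul, mul_comm, div_eq_mul_inv, Polynomial.aeval_def, Polynomial.eval₂_eq_eval_map,
    descPochhammer_map]

namespace IsHomWithPart

variable {σ : Vect →ₗ[ℝ] PsiD} {k₀ k₁ k₂ k₃ a b : ℂ}

/-- Terms of order at most `-3` have degree at least `3`, whatever they are, so up to degree `3` the
degree of `σ f` is controlled by the vanishing order of `f`. -/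
theorem fil_of_vanishesToOrder (H : IsHomWithPart σ k₀ k₁ k₂ k₃ a b) {m : ℕ} (hm : m ≤ 3)
    {f : Vect} (hf : VanishesToOrder (m + 1) f) : Fil m (σ f) := by
  have hz : ∀ n k, n + k < m + 1 → jet n (der k f) = 0 := fun n k h => by
    rw [jet_der, hf _ h, Complex.ofReal_zero]
  intro k n hkn
  rcases lt_or_ge 1 k with h1 | h1
  · rw [H.orderLE f k h1, map_zero]
  · obtain rfl | rfl | rfl | rfl : k = 1 ∨ k = 0 ∨ k = -1 ∨ k = -2 := by omega
    · rw [H.coef_one, hz _ _ (by omega)]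
    · rw [H.coef_zero, map_add, map_smul, map_smul, hz _ _ (by omega), hz _ _ (by omega)]; simp
    · rw [H.coef_neg_one, map_add, map_smul, map_smul, hz _ _ (by omega), hz _ _ (by omega)]; simp
    · rw [H.coef_neg_two, map_add, map_smul, map_smul, hz _ _ (by omega), hz _ _ (by omega)]; simp

theorem fil_sin_pow (H : IsHomWithPart σ k₀ k₁ k₂ k₃ a b) {m : ℕ} (hm : m ≤ 3) :
    Fil m (σ (sinFun ^ (m + 1))) :=
  H.fil_of_vanishesToOrder hm ((vanishesToOrder_sinFun.pow (m + 1)).mono (by omega))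

theorem fil_bracket (H : IsHomWithPart σ k₀ k₁ k₂ k₃ a b) {d e : ℤ} {f g : Vect}
    (hf : Fil d (σ f)) (hg : Fil e (σ g)) : Fil (d + e) (σ (vectBracket f g)) := by
  rw [H.hom]
  exact hf.bracket hg

/-- Expressing `sin⁴ x (1 - cos x)` by brackets shows that its image has degree at least `4`. -/
theorem fil_four (H : IsHomWithPart σ k₀ k₁ k₂ k₃ a b) :
    Fil 4 (σ (sinFun ^ 4 * (1 - cosFun))) := by
  have e : 2 * (sinFun ^ 4 * (1 - cosFun)) =
      vectBracket (1 - cosFun) (sinFun ^ 3 * (1 - cosFun)) -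
        vectBracket ((1 - cosFun) * (1 - cosFun)) (sinFun ^ 3) := by
    rw [vectBracket_mul_sub, map_sub, D_one, D_cosFun]
    ring
  have hq := vanishesToOrder_one_sub_cosFun
  refine fil_of_two_mul ?_
  rw [e, linearMap_sub]
  refine (H.fil_bracket (d := 1) (e := 3) ?_ ?_).sub
    ((H.fil_bracket (d := 3) (e := 2) ?_ ?_).anti (by norm_num))
  · exact H.fil_of_vanishesToOrder (m := 1) (by norm_num) hq
  · exact H.fil_of_vanishesToOrder (m := 3) le_rfl
      (((vanishesToOrder_sinFun.pow 3).mul hq).mono (by norm_num))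
  · exact H.fil_of_vanishesToOrder (m := 3) le_rfl (hq.mul hq)
  · exact H.fil_sin_pow (m := 2) (by norm_num)

/-- The same identity, with `fil_four` as input, gains one more degree. -/
theorem fil_five (H : IsHomWithPart σ k₀ k₁ k₂ k₃ a b) :
    Fil 5 (σ (sinFun ^ 5 * (1 - cosFun))) := by
  have e : 2 * (sinFun ^ 5 * (1 - cosFun)) =
      vectBracket (1 - cosFun) (sinFun ^ 4 * (1 - cosFun)) -
        vectBracket ((1 - cosFun) * (1 - cosFun)) (sinFun ^ 4) := by
    rw [vectBracket_mul_sub, map_sub, D_one, D_cosFun]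
    ring
  have hq := vanishesToOrder_one_sub_cosFun
  refine fil_of_two_mul ?_
  rw [e, linearMap_sub]
  refine (H.fil_bracket (d := 1) (e := 4) ?_ H.fil_four).sub
    ((H.fil_bracket (d := 3) (e := 3) ?_ ?_).anti (by norm_num))
  · exact H.fil_of_vanishesToOrder (m := 1) (by norm_num) hq
  · exact H.fil_of_vanishesToOrder (m := 3) le_rfl (hq.mul hq)
  · exact H.fil_sin_pow (m := 3) le_rfl

theorem sin_pow_four (H : IsHomWithPart σ k₀ k₁ k₂ k₃ a b) : σ (sinFun ^ 4) =
    bracket (σ (sinFun ^ 2)) (σ (sinFun ^ 3)) + σ (sinFun ^ 4 * (1 - cosFun)) := by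
  rw [← H.hom, ← map_add, vectBracket_pow 1 2]
  congr 1
  push_cast
  ring

theorem two_mul_sin_pow_five (H : IsHomWithPart σ k₀ k₁ k₂ k₃ a b) : σ (2 * sinFun ^ 5) =
    bracket (σ (sinFun ^ 2)) (σ (sinFun ^ 4)) + σ (2 * (sinFun ^ 5 * (1 - cosFun))) := by
  rw [← H.hom, ← map_add, vectBracket_pow 1 3]
  congr 1
  push_cast
  ring

/-- The image of the relation `[e₁, e₄] = 3 [e₂, e₃]`, which holds for `eⱼ = sin^(j+1) x ∂` since
`[sin^(i+1) x ∂, sin^(j+1) x ∂] = (j - i) sin^(i+j+1) x cos x ∂`. -/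
theorem bracket_relation (H : IsHomWithPart σ k₀ k₁ k₂ k₃ a b) :
    bracket (σ (sinFun ^ 2)) (σ (sinFun ^ 5)) =
      (3 : ℂ) • bracket (σ (sinFun ^ 3)) (σ (sinFun ^ 4)) := by
  rw [← H.hom, ← H.hom, vectBracket_pow 1 4, vectBracket_pow 2 3]
  have : ((4 : ℕ) - (1 : ℕ) : Vect) * (sinFun ^ (1 + 4 + 1) * cosFun) =
      (3 : ℝ) • (((3 : ℕ) - (2 : ℕ) : Vect) * (sinFun ^ (2 + 3 + 1) * cosFun)) := by
    rw [Algebra.smul_def, map_ofNat]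
    push_cast
    ring
  rw [this, map_smul]
  refine PsiD_ext fun k => ?_
  rw [coef_smul]
  change (3 : ℝ) • coef _ k = _
  rw [← Complex.coe_smul]
  norm_num

/-- Vanishing to order five alone would only give degree `3`. -/
theorem fil_sin_pow_five (H : IsHomWithPart σ k₀ k₁ k₂ k₃ a b) : Fil 4 (σ (sinFun ^ 5)) := by
  refine fil_of_two_mul ?_
  rw [H.two_mul_sin_pow_five, linearMap_two_mul]
  have h5 := H.fil_five.anti (show (4 : ℤ) ≤ 5 by norm_num)
  exact ((H.fil_sin_pow (m := 1) (by norm_num)).bracket (H.fil_sin_pow (m := 3) le_rfl)).add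
    (h5.add h5)

theorem lead_one_sin_sq (H : IsHomWithPart σ k₀ k₁ k₂ k₃ a b) :
    lead 1 (σ (sinFun ^ 2)) 0 = 2 * k₂ ∧ lead 1 (σ (sinFun ^ 2)) 1 = 2 * k₁ ∧
      lead 1 (σ (sinFun ^ 2)) 2 = 2 := by
  have h2 := vanishesToOrder_sinFun.pow 2
  refine ⟨?_, ?_, ?_⟩
  · simp [lead, H.coef_neg_one, jet_der, h2 1, jet_two_sinFun_sq, mul_comm]
  · simp [lead, H.coef_zero, jet_der, h2 1, jet_two_sinFun_sq, mul_comm]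
  · have : ((2 : ℕ) : ℤ) - 1 = 1 := by norm_num
    rw [lead, this]
    simp [H.coef_one, jet_der, jet_two_sinFun_sq]

theorem lead_two_sin_cube (H : IsHomWithPart σ k₀ k₁ k₂ k₃ a b) :
    lead 2 (σ (sinFun ^ 3)) 0 = 6 * k₃ ∧ lead 2 (σ (sinFun ^ 3)) 1 = 6 * k₂ ∧
      lead 2 (σ (sinFun ^ 3)) 2 = 6 * k₁ ∧ lead 2 (σ (sinFun ^ 3)) 3 = 6 := by
  have h2 := vanishesToOrder_sinFun.pow 3
  refine ⟨?_, ?_, ?_, ?_⟩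
  · simp [lead, H.coef_neg_two, jet_der, h2 2, jet_three_sinFun_cube, mul_comm]
  · have : ((1 : ℕ) : ℤ) - 2 = -1 := by norm_num
    rw [lead, this]
    simp [H.coef_neg_one, jet_der, h2 2, jet_three_sinFun_cube, mul_comm]
  · simp [lead, H.coef_zero, jet_der, h2 2, jet_three_sinFun_cube, mul_comm]
  · have : ((3 : ℕ) : ℤ) - 2 = 1 := by norm_num
    rw [lead, this]
    simp [H.coef_one, jet_der, jet_three_sinFun_cube]

theorem lead_eq_zero (H : IsHomWithPart σ k₀ k₁ k₂ k₃ a b) (f : Vect) (d : ℕ) (n : ℕ)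
    (hn : d + 2 ≤ n) : lead d (σ f) n = 0 := (H.orderLE f).lead_eq_zero (by omega)

set_option linter.unusedSimpArgs false in
/-- The leading part of `[σ e₁, σ e₂]`; the remainder of `σ e₃` has degree at least `4`. -/
theorem lead_three_sin_pow_four (H : IsHomWithPart σ k₀ k₁ k₂ k₃ a b) :
    lead 3 (σ (sinFun ^ 4)) 0 = -12 * k₂ ^ 2 + 12 * k₁ * k₂ - 12 * k₂ + 24 * k₁ * k₃ - 36 * k₃ ∧
    lead 3 (σ (sinFun ^ 4)) 1 = 24 * k₃ ∧ lead 3 (σ (sinFun ^ 4)) 2 = 24 * k₂ ∧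
    lead 3 (σ (sinFun ^ 4)) 3 = 24 * k₁ ∧ lead 3 (σ (sinFun ^ 4)) 4 = 24 := by
  obtain ⟨a0, a1, a2⟩ := H.lead_one_sin_sq
  obtain ⟨b0, b1, b2, b3⟩ := H.lead_two_sin_cube
  have az : ∀ n, 3 ≤ n → lead 1 (σ (sinFun ^ 2)) n = 0 := H.lead_eq_zero _ 1
  have bz : ∀ n, 4 ≤ n → lead 2 (σ (sinFun ^ 3)) n = 0 := H.lead_eq_zero _ 2
  have key (n : ℕ) := lead_bracket (d := 1) (e := 2) (H.orderLE _) (H.orderLE _)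
      (H.fil_sin_pow (m := 1) (by norm_num)) (H.fil_sin_pow (m := 2) (by norm_num)) n 6 (by omega)
  have key' (n : ℕ) : lead 3 (σ (sinFun ^ 4)) n =
      lead (1 + 2) (bracket (σ (sinFun ^ (1 + 1))) (σ (sinFun ^ (2 + 1)))) n := by
    rw [H.sin_pow_four, lead_add, H.fil_four.lead_eq_zero (by norm_num), add_zero]
    rfl
  refine ⟨?_, ?_, ?_, ?_, ?_⟩
  all_goals
    rw [key', key]
    simp [Nat.antidiagonal_succ, sum_range_succ, cast_choose_eq, prod_range_succ, a0, a1, a2, b0,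
      b1, b2, b3, az, bz, Nat.factorial, Nat.choose]
    try ring

set_option linter.unusedSimpArgs false in
set_option maxHeartbeats 800000 in
/-- The leading part of `[σ e₁, σ e₃] / 2`; the remainder of `σ e₄` has degree at least `5`. -/
theorem lead_four_sin_pow_five (H : IsHomWithPart σ k₀ k₁ k₂ k₃ a b) :
    lead 4 (σ (sinFun ^ 5)) 0 = -36 * k₁ * k₂ ^ 2 + 96 * k₂ ^ 2 - 24 * k₂ * k₃ - 132 * k₁ * k₂
      + 96 * k₂ + 36 * k₁ ^ 2 * k₂ + 72 * k₁ ^ 2 * k₃ - 252 * k₁ * k₃ + 216 * k₃ ∧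
    lead 4 (σ (sinFun ^ 5)) 1 = -60 * k₂ ^ 2 + 60 * k₁ * k₂ - 60 * k₂ + 120 * k₁ * k₃ - 180 * k₃ ∧
    lead 4 (σ (sinFun ^ 5)) 2 = 120 * k₃ ∧ lead 4 (σ (sinFun ^ 5)) 3 = 120 * k₂ ∧
    lead 4 (σ (sinFun ^ 5)) 4 = 120 * k₁ ∧ lead 4 (σ (sinFun ^ 5)) 5 = 120 := by
  obtain ⟨a0, a1, a2⟩ := H.lead_one_sin_sq
  obtain ⟨b0, b1, b2, b3, b4⟩ := H.lead_three_sin_pow_four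
  have az : ∀ n, 3 ≤ n → lead 1 (σ (sinFun ^ 2)) n = 0 := H.lead_eq_zero _ 1
  have bz : ∀ n, 5 ≤ n → lead 3 (σ (sinFun ^ 4)) n = 0 := H.lead_eq_zero _ 3
  have key (n : ℕ) := lead_bracket (d := 1) (e := 3) (H.orderLE _) (H.orderLE _)
      (H.fil_sin_pow (m := 1) (by norm_num)) (H.fil_sin_pow (m := 3) (by norm_num)) n 7 (by omega)
  have key' (n : ℕ) : lead 4 (σ (sinFun ^ 5)) n =
      lead (1 + 3) (bracket (σ (sinFun ^ (1 + 1))) (σ (sinFun ^ (3 + 1)))) n / 2 := by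
    have h := congrArg (fun F => lead 4 F n) H.two_mul_sin_pow_five
    simp only [linearMap_two_mul, lead_add, H.fil_five.lead_eq_zero (show (4 : ℤ) < 5 by norm_num),
      add_zero] at h
    rw [eq_div_iff two_ne_zero, mul_two]
    exact h
  refine ⟨?_, ?_, ?_, ?_, ?_, ?_⟩
  all_goals
    rw [key', key]
    simp [Nat.antidiagonal_succ, sum_range_succ, cast_choose_eq, prod_range_succ, a0, a1, a2, b0,
      b1, b2, b3, b4, az, bz, Nat.factorial, Nat.choose]
    try ring

set_option linter.unusedSimpArgs false in
/-- The obstruction: the constant term at `ξ⁻⁵` of the relation `[σ e₁, σ e₄] = 3 [σ e₂, σ e₃]`. -/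
theorem obstruction_eq_zero (H : IsHomWithPart σ k₀ k₁ k₂ k₃ a b) :
    6 * k₁ ^ 3 * k₃ - 3 * k₁ ^ 2 * k₂ ^ 2 - 18 * k₁ * k₂ * k₃ + 8 * k₂ ^ 3 + 9 * k₃ ^ 2
      + 3 * k₁ ^ 3 * k₂ - 6 * k₁ * k₂ ^ 2 - 9 * k₁ ^ 2 * k₃ + 18 * k₂ * k₃
      + 3 * k₁ * k₃ - 5 * k₁ ^ 2 * k₂ + 8 * k₂ ^ 2 + 2 * k₁ * k₂ = 0 := by
  obtain ⟨a0, a1, a2⟩ := H.lead_one_sin_sq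
  obtain ⟨b0, b1, b2, b3⟩ := H.lead_two_sin_cube
  obtain ⟨c0, c1, c2, c3, c4⟩ := H.lead_three_sin_pow_four
  obtain ⟨d0, d1, d2, d3, d4, d5⟩ := H.lead_four_sin_pow_five
  have az : ∀ n, 3 ≤ n → lead 1 (σ (sinFun ^ 2)) n = 0 := H.lead_eq_zero _ 1
  have bz : ∀ n, 4 ≤ n → lead 2 (σ (sinFun ^ 3)) n = 0 := H.lead_eq_zero _ 2
  have cz : ∀ n, 5 ≤ n → lead 3 (σ (sinFun ^ 4)) n = 0 := H.lead_eq_zero _ 3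
  have dz : ∀ n, 6 ≤ n → lead 4 (σ (sinFun ^ 5)) n = 0 := H.lead_eq_zero _ 4
  have k14 := lead_bracket (d := 1) (e := 4) (H.orderLE _) (H.orderLE _)
    (H.fil_sin_pow (m := 1) (by norm_num)) H.fil_sin_pow_five 0 8 (by norm_num)
  have k23 := lead_bracket (d := 2) (e := 3) (H.orderLE _) (H.orderLE _)
    (H.fil_sin_pow (m := 2) (by norm_num)) (H.fil_sin_pow (m := 3) (by norm_num)) 0 8 (by norm_num)
  have h := congrArg (fun F => lead 5 F 0) H.bracket_relation
  have h' : lead (1 + 4) (bracket (σ (sinFun ^ (1 + 1))) (σ (sinFun ^ 5))) 0 =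
      3 * lead (2 + 3) (bracket (σ (sinFun ^ (2 + 1))) (σ (sinFun ^ (3 + 1)))) 0 := by
    refine h.trans ?_
    simp [lead]
  rw [k14, k23] at h'
  simp [sum_range_succ, cast_choose_eq, prod_range_succ, a0, a1, a2, b0, b1, b2, b3, c0, c1, c2,
    c3, c4, d0, d1, d2, d3, d4, d5, az, bz, cz, dz, Nat.factorial] at h'
  linear_combination h' / 96

end IsHomWithPart

/-- Rescaling by `h⁻¹ Φ_h` turns homomorphisms into `ΨD_h(S¹)` into homomorphisms into `ΨD(S¹)`. -/
theorem isHomWithPart_of_hasInfinitesimalPart {h : ℝ} (hh : h ≠ 0) {c₀ c₁ c₂ c₃ : ℂ}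
    {ρ : Vect →ₗ[ℝ] PsiD} (hom : ∀ f g, ρ (vectBracket f g) = bracketH h (ρ f) (ρ g))
    {a b : ℂ} (hab : ∀ f, OrderLE (ρ f - (infDefH h c₀ c₁ c₂ c₃ f +
      c₀ • (a • mono (-1) (der 1 f) + b • mono (-2) (der 2 f)))) (-3)) :
    IsHomWithPart ((((h : ℂ)⁻¹ • Phi h).restrictScalars ℝ).comp ρ)
      (c₀ / h) (c₁ / h) (c₂ / h ^ 2) (c₃ / h ^ 3) (c₀ * a / h ^ 2) (c₀ * b / h ^ 3) := by
  have h0 : (h : ℂ) ≠ 0 := by exact_mod_cast hh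
  have coef_eq : ∀ f k, -3 < k → coef (ρ f) k = coef (infDefH h c₀ c₁ c₂ c₃ f) k +
      c₀ • (a • (if k = -1 then der 1 f else 0) + b • if k = -2 then der 2 f else 0) := by
    intro f k hk
    have := hab f k hk
    rwa [coef_sub, sub_eq_zero, coef_add, coef_smul, coef_add, coef_smul, coef_smul, coef_mono,
      coef_mono] at this
  have happ : ∀ f, ((((h : ℂ)⁻¹ • Phi h).restrictScalars ℝ).comp ρ) f =
      (h : ℂ)⁻¹ • Phi h (ρ f) := fun f => rfl
  refine ⟨fun f g => ?_, fun f k hk => ?_, fun f => ?_, fun f => ?_, fun f => ?_, fun f => ?_⟩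
  · rw [happ, happ, happ, bracket_smul_smul, hom, bracketH_eq, map_smul, Phi_Phi_inv hh, smul_smul]
  · rw [happ, coef_smul, coef_Phi, coef_eq f k (by omega), orderLE_infDefH _ _ _ _ _ _ hk]
    simp [show k ≠ -1 by omega, show k ≠ -2 by omega]
  · rw [happ, coef_smul, coef_Phi, coef_eq f _ (by omega), coef_infDefH_one]
    simp
    match_scalars
    simp [h0]
  · rw [happ, coef_smul, coef_Phi, coef_eq f _ (by omega), coef_infDefH_zero]
    simp
    match_scalars <;> field_simp
  · rw [happ, coef_smul, coef_Phi, coef_eq f _ (by omega), coef_infDefH_neg_one _ _ _ _ _ hh]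
    simp
    match_scalars <;> field_simp
  · rw [happ, coef_smul, coef_Phi, coef_eq f _ (by omega), coef_infDefH_neg_two _ _ _ _ _ hh]
    simp [zpow_neg]
    match_scalars <;> field_simp

theorem extends_iff {h : ℝ} (hh : h ≠ 0) (c₀ c₁ c₂ c₃ : ℂ) :
    ExtendsToPolynomialDeformation (bracketH h) c₀ (infDefH h c₀ c₁ c₂ c₃) ↔
      (6 * c₁ ^ 3 * c₃ - 3 * c₁ ^ 2 * c₂ ^ 2 - 18 * c₁ * c₂ * c₃ + 8 * c₂ ^ 3 + 9 * c₃ ^ 2)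
      + (h : ℂ) * (3 * c₁ ^ 3 * c₂ - 6 * c₁ * c₂ ^ 2 - 9 * c₁ ^ 2 * c₃ + 18 * c₂ * c₃)
      + (h : ℂ) ^ 2 * (3 * c₁ * c₃ - 5 * c₁ ^ 2 * c₂ + 8 * c₂ ^ 2)
      + (h : ℂ) ^ 3 * (2 * c₁ * c₂) = 0 := by
  refine ⟨fun ⟨n, ρ, hρ, t, a, b, hab⟩ => ?_, extends_of_eq_zero hh⟩
  have h0 : (h : ℂ) ≠ 0 := by exact_mod_cast hh
  have key := (isHomWithPart_of_hasInfinitesimalPart hh (hρ.hom t) hab).obstruction_eq_zero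
  field_simp at key
  linear_combination key

/-! ### The case `h = 1` -/

theorem Phi_one (F : PsiD) : Phi 1 F = F := PsiD_ext fun k => by simp

theorem bracketH_one : bracketH 1 = bracket := by
  funext F G
  rw [bracketH_eq, inv_one, Phi_one, Phi_one, Phi_one]
  simp

theorem infDefH_one (c₀ c₁ c₂ c₃ : ℂ) : infDefH 1 c₀ c₁ c₂ c₃ = infDef c₀ c₁ c₂ c₃ := by
  funext f
  simp only [infDefH, infDef, inv_one, Phi_one, Complex.ofReal_one, one_pow, mul_one]

end PseudoDiff

end

theorem theorem7p1 :
    (∀ c₀ c₁ c₂ c₃ : ℂ,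
      PseudoDiff.ExtendsToPolynomialDeformation PseudoDiff.bracket c₀
          (PseudoDiff.infDef c₀ c₁ c₂ c₃) ↔
        6 * c₁ ^ 3 * c₃ - 3 * c₁ ^ 2 * c₂ ^ 2 - 18 * c₁ * c₂ * c₃ + 8 * c₂ ^ 3 + 9 * c₃ ^ 2
          + 3 * c₁ ^ 3 * c₂ - 6 * c₁ * c₂ ^ 2 - 9 * c₁ ^ 2 * c₃ + 18 * c₂ * c₃
          + 3 * c₁ * c₃ - 5 * c₁ ^ 2 * c₂ + 8 * c₂ ^ 2 + 2 * c₁ * c₂ = 0) ∧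
    (∀ h : ℝ, 0 < h → h ≤ 1 → ∀ c₀ c₁ c₂ c₃ : ℂ,
      PseudoDiff.ExtendsToPolynomialDeformation (PseudoDiff.bracketH h) c₀
          (PseudoDiff.infDefH h c₀ c₁ c₂ c₃) ↔
        (6 * c₁ ^ 3 * c₃ - 3 * c₁ ^ 2 * c₂ ^ 2 - 18 * c₁ * c₂ * c₃ + 8 * c₂ ^ 3 + 9 * c₃ ^ 2)
          + (h : ℂ) * (3 * c₁ ^ 3 * c₂ - 6 * c₁ * c₂ ^ 2 - 9 * c₁ ^ 2 * c₃ + 18 * c₂ * c₃)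
          + (h : ℂ) ^ 2 * (3 * c₁ * c₃ - 5 * c₁ ^ 2 * c₂ + 8 * c₂ ^ 2)
          + (h : ℂ) ^ 3 * (2 * c₁ * c₂) = 0) := by
  refine ⟨fun c₀ c₁ c₂ c₃ => ?_, fun h hpos _ => PseudoDiff.extends_iff hpos.ne'⟩
  have key := PseudoDiff.extends_iff one_ne_zero c₀ c₁ c₂ c₃
  rw [PseudoDiff.bracketH_one, PseudoDiff.infDefH_one] at key
  refine key.trans (Eq.congr_left ?_)
  push_cast
  ring
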